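/- Let $S$ be a non-empty finite set and let $\rho:S\times S\to\mathbb{R}_{\ge 0}$ be a dissimilarity, i.e. $\rho$ is symmetric and $\rho(x,y)=0$ if and only if $x=y$. Assume that $(S,\rho)$ is \emph{Robinson}, i.e. there is a total order $<$ on $S$ with $\rho(x,z)\ge\max\{\rho(x,y),\rho(y,z)\}$ whenever $x<y<z$, and \emph{strict}, i.e. $\rho(x,y)\ne\rho(u,v)$ for any two distinct unordered pairs $\{x,y\}\neq\{u,v\}$ with $x\ne y$ or $u\ne v$. Let $(T,d)$ be a real tree, i.e. a path-connected metric space in which any two points are joined by a unique geodesic and, for any three points $x,y,z$, the geodesics $[x,y]$, $[y,z]$, $[z,x]$ have a common point. Let $I:S\to T$ be a valid drawing of $(S,\rho)$ in $T$, i.e. an injection such that $d(I(x),I(y))<d(I(x),I(z))$ for all $x,y,z\in S$ with $\rho(x,y)<\rho(x,z)$. Then: 1. The finite metric space $(I(S),d)$ satisfies the Strong-four-point-condition: it satisfies the four-point condition $$d(x,y)+d(u,v)\le\max\{d(x,u)+d(y,v),\,d(x,v)+d(y,u)\}\quad\text{for all }x,y,u,v\in I(S),$$ and there is a total order $<$ on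 $I(S)$ such that for all $i<j<k<l$ in $I(S)$ $$d(i,j)+d(k,l)\le d(i,k)+d(j,l)=d(i,l)+d(j,k).$$ 2. The subtree $T_I=\bigcup_{x,y\in S}[I(x),I(y)]$ of $T$ spanned by the drawn points is a caterpillar in which every drawn point is a vertex. That is, $T_I$ (with the metric $d$) is a real tree, and there are a finite set $V\subseteq T_I$ containing $I(S)$ and a tree graph $G$ with vertex set $V$ such that: $G$ is a caterpillar, i.e. it contains a path (the spine) such that every vertex not on the spine is a leaf attached to a vertex of the spine; when each edge $uv$ of $G$ is given the weight $d(u,v)$, the length of the path of $G$ between any two vertices $u,v$ is $d(u,v)$; and $T_I$ is the union of $V$ and of the geodesics $[u,v]$ over the edges $uv$ of $G$. -/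

import Mathlib

namespace RobinsonTree

/-! ### Dissimilarity spaces and Robinson spaces -/

/-- `ρ` is a dissimilarity on `S`. -/
structure IsDissimilarity {S : Type*} (ρ : S → S → ℝ) : Prop where
  nonneg : ∀ x y, 0 ≤ ρ x y
  symm : ∀ x y, ρ x y = ρ y x
  eq_zero_iff : ∀ x y, ρ x y = 0 ↔ x = y

/-- `ρ` separates any two distinct unordered pairs that are not both on the diagonal. -/
def IsStrict {S : Type*} (ρ : S → S → ℝ) : Prop :=
  ∀ x y u v : S, s(x, y) ≠ s(u, v) → (x ≠ y ∨ u ≠ v) → ρ x y ≠ ρ u v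

/-- `ρ` admits a compatible order. -/
def IsRobinson {S : Type*} (ρ : S → S → ℝ) : Prop :=
  ∃ _ : LinearOrder S, ∀ x y z : S, x < y → y < z → max (ρ x y) (ρ y z) ≤ ρ x z

/-- `(S, ρ)` is a strict Robinson (dissimilarity) space. -/
structure IsStrictRobinson {S : Type*} (ρ : S → S → ℝ) : Prop where
  dissimilarity : IsDissimilarity ρ
  strict : IsStrict ρ
  robinson : IsRobinson ρ

/-- `I` is a valid drawing of `(S, ρ)` in the metric space `X`. -/
structure IsValidDrawing {S X : Type*} [MetricSpace X] (ρ : S → S → ℝ) (I : S → X) : Prop where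
  injective : Function.Injective I
  dist_lt : ∀ x y z : S, ρ x y < ρ x z → dist (I x) (I y) < dist (I x) (I z)

/-! ### Geodesics and real trees -/

/-- The set `s` is (the image of) a geodesic from `x` to `y`. -/
def IsGeodesic {X : Type*} [MetricSpace X] (x y : X) (s : Set X) : Prop :=
  ∃ γ : ℝ → X, γ 0 = x ∧ γ (dist x y) = y ∧
    (∀ a ∈ Set.Icc 0 (dist x y), ∀ b ∈ Set.Icc 0 (dist x y), dist (γ a) (γ b) = |a - b|) ∧
    s = γ '' Set.Icc 0 (dist x y)

/-- The union of the geodesics from `x` to `y`; in a real tree this is the unique geodesic. -/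
def seg {X : Type*} [MetricSpace X] (x y : X) : Set X :=
  {p | ∃ s, IsGeodesic x y s ∧ p ∈ s}

/-- Real trees: path-connected spaces in which any two points are joined by a unique geodesic and
the three geodesics between any three points have a common point. -/
structure IsRealTree (X : Type*) [MetricSpace X] : Prop where
  pathConnected : PathConnectedSpace X
  existsUnique_geodesic : ∀ x y : X, ∃! s, IsGeodesic x y s
  exists_center : ∀ x y z : X, ∃ c, c ∈ seg x y ∧ c ∈ seg y z ∧ c ∈ seg z x

/-- The tree spanned by the points `I x`: the union of the geodesics between them. -/
def spannedTree {S X : Type*} [MetricSpace X] (I : S → X) : Set X :=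
  ⋃ (x : S) (y : S), seg (I x) (I y)

/-- The points `I x` belong to the tree that they span. -/
theorem range_subset_spannedTree {S X : Type*} [MetricSpace X] (I : S → X) :
    Set.range I ⊆ spannedTree I := by
  rintro _ ⟨x, rfl⟩
  simp only [spannedTree, Set.mem_iUnion]
  refine ⟨x, x, {I x}, ⟨fun _ => I x, rfl, rfl, ?_, ?_⟩, rfl⟩
  · intro a ha b hb
    simp only [dist_self, Set.Icc_self, Set.mem_singleton_iff] at ha hb
    simp [ha, hb]
  · simp

/-! ### The four-point conditions -/

/-- The four-point condition; the four points need not be distinct. -/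
def FourPointCondition (X : Type*) [MetricSpace X] : Prop :=
  ∀ x y u v : X, dist x y + dist u v ≤ max (dist x u + dist y v) (dist x v + dist y u)

/-- The strong four-point condition; the four points are distinct and listed in increasing
order. -/
def StrongFourPointCondition (X : Type*) [MetricSpace X] : Prop :=
  FourPointCondition X ∧ ∃ _ : LinearOrder X, ∀ i j k l : X, i < j → j < k → k < l →
    dist i j + dist k l ≤ dist i k + dist j l ∧
      dist i k + dist j l = dist i l + dist j k

/-! ### Caterpillars -/

/-- A caterpillar graph: a tree with a path (the spine) such that every vertex outside the spine
is a leaf attached to a vertex of the spine. -/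
def IsCaterpillarGraph {V : Type*} (G : SimpleGraph V) : Prop :=
  G.IsTree ∧ ∃ (a b : V) (spine : G.Walk a b), spine.IsPath ∧
    ∀ w, w ∉ spine.support → ∃ s ∈ spine.support, ∀ x, G.Adj w x ↔ x = s

/-- The length of a walk through points of a metric space, the weight of an edge being the
distance between its ends. -/
noncomputable def walkLength {X : Type*} [MetricSpace X] {V : Set X} {G : SimpleGraph V} {u v : V}
    (p : G.Walk u v) : ℝ :=
  (p.darts.map fun e => dist (e.fst : X) (e.snd : X)).sum

/-- The real tree `X` is a caterpillar having all points of `P` among its vertices: `X` is a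
weighted finite caterpillar graph, with vertices in `X`, whose edges are geodesics of `X` that
cover `X`, and whose path metric is the metric of `X`. -/
def IsCaterpillarWith (X : Type*) [MetricSpace X] (P : Set X) : Prop :=
  IsRealTree X ∧ ∃ (V : Set X) (G : SimpleGraph V),
    V.Finite ∧ P ⊆ V ∧ IsCaterpillarGraph G ∧
    (∀ (u v : V) (p : G.Walk u v), p.IsPath → walkLength p = dist (u : X) (v : X)) ∧
    (∀ q : X, q ∈ V ∨ ∃ u v : V, G.Adj u v ∧ q ∈ seg (u : X) (v : X))

end RobinsonTree

/-!
Everything is expressed through metric betweenness: in a real tree a point `p` lies on the geodesic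
from `x` to `y` exactly when `dist x p + dist p y = dist x y` (`IsRealTree.mem_seg_iff`).

*The four-point conditions.* Projecting two points onto the geodesic between two others gives the
four-point condition (`IsRealTree.fourPointCondition`): the two largest of the three sums of
distances between opposite pairs agree. In a valid drawing of a strict Robinson space,
`x < y < z` implies that `dist (I x) (I z)` is strictly larger than `dist (I x) (I y)` and
`dist (I y) (I z)` (`dist_lt_of_isValidDrawing`). So, for `i < j < k < l`, the sum `ik + jl` strictly
exceeds `ij + kl`, and then `ik + jl = il + jk`.

*The spanned tree* is convex, hence a real tree. Let `⊥` and `⊤` be the extreme points of `S` and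
`p j` the projection of `I j` to the geodesic from `I ⊥` to `I ⊤`. The strong condition shows
that the projections are met in the order of `S` and that
`dist (I j) (I k) = dist (I j) (p j) + dist (p j) (p k) + dist (p k) (I k)` for `j ≠ k`. So the
vertex set `V`, which consists of all `I j` and `p j`, is closed under medians, and the geodesic from
`I j` to any other vertex starts with the leg from `I j` to `p j`.

*The graph.* Two vertices are adjacent when no vertex lies strictly between them
(`neighborGraph`). For a finite `V` closed under medians, consecutive edges of a path
do not backtrack, and in a real tree such a local geodesic is a geodesic; this makes the graph a
tree whose path metric is the given metric. The path from `I ⊥` to `I ⊤` passes through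
all `p j`, and a vertex off this path is some `I j`, whose only neighbour is `p j`.
-/

namespace RobinsonTree

open Set

/-! ### Betweenness in real trees -/

/-- The point `p` lies metrically between `x` and `y` (possibly at an end). -/
def Between {X : Type*} [MetricSpace X] (x p y : X) : Prop :=
  dist x p + dist p y = dist x y

section Between

variable {X : Type*} [MetricSpace X] {x y z p q : X}

theorem Between.symm (h : Between x p y) : Between y p x := by
  unfold Between at *
  rw [dist_comm y p, dist_comm p x, dist_comm y x]
  linarith

theorem between_left (x y : X) : Between x x y := by simp [Between]

theorem between_right (x y : X) : Between x y y := by simp [Between]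

theorem Between.eq_of_self (h : Between x p x) : p = x := by
  unfold Between at h
  rw [dist_comm p x, dist_self] at h
  exact (dist_eq_zero.1 (by linarith : dist x p = 0)).symm

theorem between_of_le (h : dist x p + dist p y ≤ dist x y) : Between x p y :=
  le_antisymm h (dist_triangle _ _ _)

theorem Between.trans_left (h : Between x q y) (h' : Between x p q) : Between x p y := by
  unfold Between at h h'
  apply between_of_le
  linarith [dist_triangle p q y]

theorem Between.trans_right (h : Between x q y) (h' : Between q p y) : Between x p y :=
  (h.symm.trans_left h'.symm).symm

theorem Between.antisymm (h : Between x p y) (h' : Between x y p) : p = y := by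
  unfold Between at h h'
  rw [dist_comm y p] at h'
  exact dist_eq_zero.1 (by linarith [dist_nonneg (x := p) (y := y)])

theorem IsGeodesic.between {s : Set X} (h : IsGeodesic x y s) (hp : p ∈ s) : Between x p y := by
  obtain ⟨γ, h0, h1, hd, rfl⟩ := h
  obtain ⟨a, ha, rfl⟩ := hp
  have e0 := hd 0 ⟨le_rfl, dist_nonneg⟩ a ha
  have e1 := hd a ha (dist x y) ⟨dist_nonneg, le_rfl⟩
  rw [h0, zero_sub, abs_neg, abs_of_nonneg ha.1] at e0
  rw [h1, abs_of_nonpos (by linarith [ha.2])] at e1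
  unfold Between
  linarith

theorem IsGeodesic.dist_eq {s : Set X} (h : IsGeodesic x y s) (hp : p ∈ s) (hq : q ∈ s) :
    dist p q = |dist x p - dist x q| := by
  obtain ⟨γ, h0, h1, hd, rfl⟩ := h
  obtain ⟨a, ha, rfl⟩ := hp
  obtain ⟨b, hb, rfl⟩ := hq
  have e0 := hd 0 ⟨le_rfl, dist_nonneg⟩ a ha
  have e1 := hd 0 ⟨le_rfl, dist_nonneg⟩ b hb
  rw [h0, zero_sub, abs_neg, abs_of_nonneg ha.1] at e0
  rw [h0, zero_sub, abs_neg, abs_of_nonneg hb.1] at e1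
  rw [hd a ha b hb, e0, e1]

end Between

namespace IsRealTree

variable {X : Type*} [MetricSpace X] {x y z p q : X}

/-- A point `p` between `x` and `y` is on the geodesic because it coincides with the centre of
`x`, `y` and `p`. -/
theorem mem_seg_iff (hX : IsRealTree X) : p ∈ seg x y ↔ Between x p y := by
  constructor
  · rintro ⟨s, hs, hp⟩
    exact hs.between hp
  · intro h
    obtain ⟨c, ⟨s, hs, h1⟩, ⟨s₂, hs₂, h2⟩, ⟨s₃, hs₃, h3⟩⟩ := hX.exists_center x y p
    have e1 := hs.between h1
    have e2 := hs₂.between h2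
    have e3 := hs₃.between h3
    unfold Between at h e1 e2 e3
    rw [dist_comm c x, dist_comm p x] at e3
    rw [dist_comm y c, dist_comm y p] at e2
    rw [dist_comm p c] at e3
    have : c = p := dist_eq_zero.1 (by linarith)
    exact this ▸ ⟨s, hs, h1⟩

theorem exists_median (hX : IsRealTree X) (x y z : X) :
    ∃ c, Between x c y ∧ Between y c z ∧ Between x c z := by
  obtain ⟨c, h1, h2, h3⟩ := hX.exists_center x y z
  exact ⟨c, hX.mem_seg_iff.1 h1, hX.mem_seg_iff.1 h2, (hX.mem_seg_iff.1 h3).symm⟩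

theorem dist_eq_abs_sub (hX : IsRealTree X) (hp : Between x p y) (hq : Between x q y) :
    dist p q = |dist x p - dist x q| := by
  obtain ⟨s, hs, hp⟩ := hX.mem_seg_iff.2 hp
  obtain ⟨s', hs', hq⟩ := hX.mem_seg_iff.2 hq
  obtain rfl := (hX.existsUnique_geodesic x y).unique hs hs'
  exact hs.dist_eq hp hq

theorem between_of_dist_le (hX : IsRealTree X) (hp : Between x p y) (hq : Between x q y)
    (h : dist x p ≤ dist x q) : Between x p q := by
  have := hX.dist_eq_abs_sub hp hq
  rw [abs_of_nonpos (by linarith)] at this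
  unfold Between
  linarith

/-- Two points of a geodesic are comparable along it. -/
theorem between_total (hX : IsRealTree X) (hp : Between x p y) (hq : Between x q y) :
    Between x p q ∨ Between q p y := by
  rcases le_total (dist x p) (dist x q) with h | h
  · exact .inl (hX.between_of_dist_le hp hq h)
  · right
    refine (hX.between_of_dist_le hp.symm hq.symm ?_).symm
    unfold Between at hp hq
    rw [dist_comm y p, dist_comm y q]
    linarith

/-- Triangles are thin: a side is contained in the union of the other two. -/
theorem between_or_between (hX : IsRealTree X) (hp : Between x p y) (z : X) :
    Between x p z ∨ Between z p y := by
  obtain ⟨c, h1, h2, h3⟩ := hX.exists_median x y z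
  rcases hX.between_total hp h1 with h | h
  · exact .inl (h3.trans_left h)
  · exact .inr (h2.symm.trans_right h)

/-- The medians of `x, y, u` and of `x, y, v` lie on the geodesic from `x` to `y`; the proof compares
their positions there. -/
theorem fourPointCondition (hX : IsRealTree X) : FourPointCondition X := by
  intro x y u v
  obtain ⟨p, p1, p2, p3⟩ := hX.exists_median x y u
  obtain ⟨q, q1, q2, q3⟩ := hX.exists_median x y v
  have hpq := hX.dist_eq_abs_sub p1 q1
  have huv := dist_triangle4 u p q v
  unfold Between at *
  rw [dist_comm u p] at huv
  rw [dist_comm y p] at p2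
  rw [dist_comm y q] at q2
  rcases le_total (dist x p) (dist x q) with h | h
  · rw [abs_of_nonpos (by linarith)] at hpq
    exact le_max_of_le_right (by linarith)
  · rw [abs_of_nonneg (by linarith)] at hpq
    exact le_max_of_le_left (by linarith)

/-- A local geodesic is a geodesic: geodesics that share a nondegenerate middle part fit
together. -/
theorem between_of_between_of_between (hX : IsRealTree X) {u v w x : X} (h : Between u v w)
    (h' : Between v w x) (hvw : v ≠ w) : Between u v x := by
  have h4 := hX.fourPointCondition u w v x
  have hpos := dist_pos.2 hvw
  apply between_of_le
  unfold Between at *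
  rw [dist_comm w v] at h4
  rcases le_max_iff.1 h4 with h4 | h4 <;> linarith

/-- Among three points of a geodesic, one is between the other two. -/
theorem exists_middle (hX : IsRealTree X) {u v a b c : X} {P : Set X}
    (hP : ∀ p ∈ P, Between u p v) (ha : a ∈ P) (hb : b ∈ P) (hc : c ∈ P) :
    ∃ m ∈ P, Between a m b ∧ Between b m c ∧ Between a m c := by
  have hab := hX.dist_eq_abs_sub (hP a ha) (hP b hb)
  have hbc := hX.dist_eq_abs_sub (hP b hb) (hP c hc)
  have hac := hX.dist_eq_abs_sub (hP a ha) (hP c hc)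
  have : Between b a c ∨ Between a b c ∨ Between a c b := by
    unfold Between
    rw [dist_comm b a, dist_comm c b, hab, hbc, hac]
    grind
  rcases this with h | h | h
  · exact ⟨a, ha, between_left _ _, h, between_left _ _⟩
  · exact ⟨b, hb, between_right _ _, between_left _ _, h⟩
  · exact ⟨c, hc, h, between_right _ _, between_right _ _⟩

end IsRealTree

/-! ### The spanned subtree -/

section Spanned

variable {S T : Type*} [MetricSpace T]

theorem mem_spannedTree_iff (hT : IsRealTree T) {I : S → T} {p : T} :
    p ∈ spannedTree I ↔ ∃ x y, Between (I x) p (I y) := by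
  simp [spannedTree, hT.mem_seg_iff]

theorem Between.mem_spannedTree (hT : IsRealTree T) {I : S → T} {p q r : T}
    (hp : p ∈ spannedTree I) (hq : q ∈ spannedTree I) (h : Between p r q) :
    r ∈ spannedTree I := by
  rw [mem_spannedTree_iff hT] at *
  obtain ⟨a, b, hp⟩ := hp
  obtain ⟨c, d, hq⟩ := hq
  rcases hT.between_or_between h (I a) with h | h
  · exact ⟨a, b, hp.trans_left h.symm⟩
  rcases hT.between_or_between h (I c) with h | h
  · exact ⟨a, c, h⟩
  · exact ⟨c, d, hq.trans_left h⟩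

theorem IsGeodesic.image_val {Y : Set T} {x y : Y} {s : Set Y} (h : IsGeodesic x y s) :
    IsGeodesic (x : T) (y : T) (Subtype.val '' s) := by
  obtain ⟨γ, h0, h1, hd, rfl⟩ := h
  exact ⟨fun t => γ t, congrArg _ h0, congrArg _ h1, hd, by
    rw [image_image]; rfl⟩

theorem IsGeodesic.preimage_val {Y : Set T}
    (hY : ∀ p ∈ Y, ∀ q ∈ Y, ∀ r, Between p r q → r ∈ Y) {x y : Y} {s : Set T}
    (hs : IsGeodesic (x : T) (y : T) s) : IsGeodesic x y (Subtype.val ⁻¹' s) := by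
  have hsY : ∀ r ∈ s, r ∈ Y := fun r hr => hY x x.2 y y.2 r (hs.between hr)
  obtain ⟨γ, h0, h1, hd, rfl⟩ := hs
  have hγ : ∀ t (ht : t ∈ Icc 0 (dist (x : T) y)), γ t ∈ Y := fun t ht => hsY _ ⟨t, ht, rfl⟩
  have h0' : (0 : ℝ) ∈ Icc 0 (dist (x : T) y) := ⟨le_rfl, dist_nonneg⟩
  have h1' : dist (x : T) y ∈ Icc 0 (dist (x : T) y) := ⟨dist_nonneg, le_rfl⟩
  classical
  let δ : ℝ → Y := fun t => if ht : γ t ∈ Y then ⟨γ t, ht⟩ else x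
  have hδ : ∀ t ∈ Icc 0 (dist (x : T) y), (δ t : T) = γ t := fun t ht => by
    simp [δ, hγ t ht]
  refine ⟨δ, Subtype.ext ?_, Subtype.ext ?_, fun a ha b hb => ?_, ?_⟩
  · rw [hδ 0 h0', h0]
  · rw [Subtype.dist_eq, hδ _ h1', h1]
  · rw [Subtype.dist_eq, hδ a ha, hδ b hb, hd a ha b hb]
  · ext r
    constructor
    · rintro ⟨t, ht, hr⟩
      exact ⟨t, ht, Subtype.ext (by rw [hδ t ht, hr])⟩
    · rintro ⟨t, ht, rfl⟩
      exact ⟨t, ht, (hδ t ht).symm⟩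

theorem IsGeodesic.joined {X : Type*} [MetricSpace X] {x y : X} {s : Set X}
    (h : IsGeodesic x y s) : Joined x y := by
  obtain ⟨γ, h0, h1, hd, -⟩ := h
  have hc : ContinuousOn γ (Icc 0 (dist x y)) := by
    refine (LipschitzOnWith.of_dist_le_mul (K := 1) fun a ha b hb => ?_).continuousOn
    rw [hd a ha b hb, Real.dist_eq, NNReal.coe_one, one_mul]
  have hp := ((convex_Icc 0 (dist x y)).isPathConnected
    (nonempty_Icc.2 dist_nonneg)).image' hc
  exact (hp.joinedIn x ⟨0, ⟨le_rfl, dist_nonneg⟩, h0⟩ y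
    ⟨_, ⟨dist_nonneg, le_rfl⟩, h1⟩).joined

/-- Convex subsets of real trees are real trees. -/
theorem IsRealTree.subtype (hT : IsRealTree T) {Y : Set T} (hne : Y.Nonempty)
    (hY : ∀ p ∈ Y, ∀ q ∈ Y, ∀ r, Between p r q → r ∈ Y) : IsRealTree Y := by
  have hex : ∀ x y : Y, ∃ s, IsGeodesic x y s := fun x y =>
    let ⟨_, hs, _⟩ := hT.existsUnique_geodesic x y
    ⟨_, IsGeodesic.preimage_val hY hs⟩
  have hseg : ∀ {x y c : Y}, (c : T) ∈ seg (x : T) y → c ∈ seg x y := fun ⟨_, hs, hc⟩ =>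
    ⟨_, IsGeodesic.preimage_val hY hs, hc⟩
  refine ⟨⟨hne.to_subtype, fun x y => ?_⟩, fun x y => ?_, fun x y z => ?_⟩
  · obtain ⟨s, hs⟩ := hex x y
    exact hs.joined
  · obtain ⟨s, hs⟩ := hex x y
    refine ⟨s, hs, fun s' hs' => Subtype.val_injective.image_injective ?_⟩
    exact (hT.existsUnique_geodesic x y).unique hs'.image_val hs.image_val
  · obtain ⟨c, h1, h2, h3⟩ := hT.exists_center x y z
    have hc : c ∈ Y := hY x x.2 y y.2 c (hT.mem_seg_iff.1 h1)
    exact ⟨⟨c, hc⟩, hseg h1, hseg h2, hseg h3⟩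

theorem isRealTree_spannedTree [Nonempty S] (hT : IsRealTree T) (I : S → T) :
    IsRealTree (spannedTree I) :=
  hT.subtype ((range_nonempty I).mono (range_subset_spannedTree I))
    fun _ hp _ hq _ h => h.mem_spannedTree hT hp hq

end Spanned

/-! ### The graph of a finite set of points closed under medians -/

/-- The graph on a set of points in which two points are adjacent when no point of the set lies
strictly between them. -/
def neighborGraph {X : Type*} [MetricSpace X] (V : Set X) : SimpleGraph V where
  Adj u v := u ≠ v ∧ ∀ w : V, Between (u : X) w v → w = u ∨ w = v
  symm := ⟨fun _ _ h => ⟨h.1.symm, fun w hw => (h.2 w hw.symm).symm⟩⟩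
  loopless := ⟨fun _ h => h.1 rfl⟩

section Graph

variable {X : Type*} [MetricSpace X] {V : Set X}

/-- Induction over pairs of points of a finite set, by subdivision of the geodesic between them at
further points of the set. -/
theorem subdivision_induction (hV : V.Finite) {motive : V → V → Prop}
    (refl : ∀ u, motive u u) (adj : ∀ u v, (neighborGraph V).Adj u v → motive u v)
    (split : ∀ u v w : V, Between (u : X) w v → motive u w → motive w v → motive u v)
    (u v : V) : motive u v := by
  have := hV.to_subtype
  induction hn : {w : V | Between (u : X) w v}.ncard using Nat.strong_induction_on
    generalizing u v with
  | _ n ih =>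
    subst hn
    by_cases huv : u = v
    · exact huv ▸ refl u
    by_cases ha : (neighborGraph V).Adj u v
    · exact adj u v ha
    obtain ⟨w, hw, hwu, hwv⟩ : ∃ w : V, Between (u : X) w v ∧ w ≠ u ∧ w ≠ v := by
      by_contra! hcon
      exact ha ⟨huv, fun w hw => or_iff_not_imp_left.2 fun h => hcon w hw h⟩
    refine split u v w hw (ih _ (ncard_lt_ncard ?_ (toFinite _)) u w rfl)
      (ih _ (ncard_lt_ncard ?_ (toFinite _)) w v rfl)
    · refine ssubset_iff_exists.2 ⟨fun z hz => hw.trans_left hz, v, between_right _ _, fun h => ?_⟩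
      exact hwv (Subtype.ext (hw.antisymm h))
    · refine ssubset_iff_exists.2 ⟨fun z hz => hw.trans_right hz, u, between_left _ _, fun h => ?_⟩
      exact hwu (Subtype.ext (hw.symm.antisymm h.symm))

theorem neighborGraph_preconnected (hV : V.Finite) : (neighborGraph V).Preconnected :=
  subdivision_induction hV (fun u => .refl u) (fun _ _ h => h.reachable)
    fun _ _ _ _ h h' => h.trans h'

theorem exists_adj_mem_seg (hX : IsRealTree X) (hV : V.Finite) {q : X} (u v : V)
    (h : Between (u : X) q v) :
    q ∈ V ∨ ∃ u v : V, (neighborGraph V).Adj u v ∧ q ∈ seg (u : X) v := by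
  revert h
  refine subdivision_induction hV (motive := fun u v => Between (u : X) q v → q ∈ V ∨ ∃ u v : V,
    (neighborGraph V).Adj u v ∧ q ∈ seg (u : X) v) ?_ ?_ ?_ u v
  · exact fun u h => .inl (h.eq_of_self ▸ u.2)
  · exact fun u v huv h => .inr ⟨u, v, huv, hX.mem_seg_iff.2 h⟩
  · intro u v w hw h1 h2 h
    exact (hX.between_total h hw).elim h1 h2

/-- Every three points of `V` have a median in `V`. -/
def MedianClosed (V : Set X) : Prop :=
  ∀ a ∈ V, ∀ b ∈ V, ∀ c ∈ V, ∃ m ∈ V, Between a m b ∧ Between b m c ∧ Between a m c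

theorem MedianClosed.between_of_adj (hm : MedianClosed V) {u v w : V}
    (huv : (neighborGraph V).Adj u v) (hvw : (neighborGraph V).Adj v w) (huw : u ≠ w) :
    Between (u : X) v w := by
  obtain ⟨m, hmV, h1, h2, h3⟩ := hm u u.2 v v.2 w w.2
  rcases huv.2 ⟨m, hmV⟩ h1 with h | h
  · rcases hvw.2 ⟨m, hmV⟩ h2 with h' | h'
    · exact absurd (h.symm.trans h') huv.1
    · exact absurd (h.symm.trans h') huw
  · exact h ▸ h3

theorem between_of_isPath_cons (hX : IsRealTree X) (hm : MedianClosed V) {u v w : V}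
    (h : (neighborGraph V).Adj u v) (p : (neighborGraph V).Walk v w)
    (hp : (SimpleGraph.Walk.cons h p).IsPath) : Between (u : X) v w := by
  induction p generalizing u with
  | nil => exact between_right _ _
  | cons h' q ih =>
    have hp' := (SimpleGraph.Walk.cons_isPath_iff _ _).1 hp
    refine hX.between_of_between_of_between (hm.between_of_adj h h' ?_) (ih h' hp'.1)
      (fun e => h'.1 (Subtype.ext e))
    rintro rfl
    exact hp'.2 (by simp)

theorem walkLength_eq_dist (hX : IsRealTree X) (hm : MedianClosed V) {u v : V}
    (p : (neighborGraph V).Walk u v) (hp : p.IsPath) : walkLength p = dist (u : X) v := by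
  induction p with
  | nil => simp [walkLength]
  | cons h q ih =>
    have hb := between_of_isPath_cons hX hm h q hp
    have := ih ((SimpleGraph.Walk.cons_isPath_iff _ _).1 hp).1
    simp only [walkLength, SimpleGraph.Walk.darts_cons, List.map_cons, List.sum_cons] at this ⊢
    rw [this]
    exact hb

/-- A path passes through every vertex that lies between its ends. -/
theorem mem_support_of_between (hX : IsRealTree X) (hm : MedianClosed V) {u v w : V}
    (p : (neighborGraph V).Walk u v) (hp : p.IsPath) (hw : Between (u : X) w v) :
    w ∈ p.support := by
  induction p with
  | nil => simp [Subtype.ext hw.eq_of_self]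
  | cons h q ih =>
    have hb := between_of_isPath_cons hX hm h q hp
    rcases hX.between_total hw hb with h1 | h1
    · rcases h.2 w h1 with rfl | rfl <;> simp
    · exact List.mem_cons_of_mem _ (ih ((SimpleGraph.Walk.cons_isPath_iff _ _).1 hp).1 h1)

theorem neighborGraph_isAcyclic (hX : IsRealTree X) (hm : MedianClosed V) :
    (neighborGraph V).IsAcyclic := by
  intro u c hc
  cases c with
  | nil => exact SimpleGraph.Walk.not_isCycle_nil hc
  | cons h p =>
    obtain ⟨hp, he⟩ := SimpleGraph.Walk.cons_isCycle_iff _ _ |>.1 hc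
    cases p with
    | nil => exact h.1 rfl
    | cons h' q =>
      -- The second vertex of the path lies between its adjacent ends.
      have hb := between_of_isPath_cons hX hm h' q hp
      rcases h.2 _ hb.symm with rfl | rfl
      · exact he (by simp [Sym2.eq_swap])
      · exact h'.1 rfl

theorem neighborGraph_isTree (hX : IsRealTree X) (hV : V.Finite) (hne : V.Nonempty)
    (hm : MedianClosed V) : (neighborGraph V).IsTree :=
  have := hne.to_subtype
  ⟨⟨neighborGraph_preconnected hV⟩, neighborGraph_isAcyclic hX hm⟩

end Graph

/-! ### Legs attached to a geodesic -/

section Legs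

variable {X : Type*} [MetricSpace X] {V : Set X} {u v : X}

/-- The set `V` consists of points of the geodesic from `u` to `v` and of ends of legs: for
`a ∈ V`, the foot `f a` lies in `V` and on the geodesic, and the geodesics from `a` to all other
points of `V` pass through `f a`. -/
structure HasFeet (V : Set X) (u v : X) (f : X → X) : Prop where
  mem : ∀ a ∈ V, f a ∈ V
  between : ∀ a ∈ V, Between u (f a) v
  foot : ∀ a ∈ V, f (f a) = f a
  leg : ∀ a ∈ V, ∀ w ∈ V, w ≠ a → Between a (f a) w

theorem HasFeet.dist_eq {f : X → X} (hf : HasFeet V u v f) {a b : X} (ha : a ∈ V) (hb : b ∈ V)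
    (hab : a ≠ b) : dist a b = dist a (f a) + dist (f a) (f b) + dist (f b) b := by
  have h1 := hf.leg a ha b hb hab.symm
  by_cases h : f a = b
  · have : f b = b := h ▸ hf.foot a ha
    simp [this, h]
  · have h2 := (hf.leg b hb (f a) (hf.mem a ha) h).symm
    unfold Between at h1 h2
    linarith

theorem HasFeet.between_of_between {f : X → X} (hf : HasFeet V u v f) {a b m : X} (ha : a ∈ V)
    (hb : b ∈ V) (hab : a ≠ b) (hm : Between (f a) m (f b)) : Between a m b := by
  have := hf.dist_eq ha hb hab
  apply between_of_le
  unfold Between at hm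
  linarith [dist_triangle a (f a) m, dist_triangle m (f b) b]

theorem HasFeet.medianClosed (hX : IsRealTree X) {f : X → X} (hf : HasFeet V u v f) :
    MedianClosed V := by
  intro a ha b hb c hc
  by_cases hab : a = b
  · exact ⟨a, ha, hab ▸ between_left _ _, hab ▸ between_left _ _, between_left _ _⟩
  by_cases hbc : b = c
  · exact ⟨b, hb, between_right _ _, hbc ▸ between_left _ _, hbc ▸ between_right _ _⟩
  by_cases hac : a = c
  · exact ⟨a, ha, between_left _ _, hac ▸ between_right _ _, between_left _ _⟩
  obtain ⟨m, hm, h1, h2, h3⟩ := hX.exists_middle (P := {p | p ∈ V ∧ Between u p v})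
    (fun p hp => hp.2) ⟨hf.mem a ha, hf.between a ha⟩ ⟨hf.mem b hb, hf.between b hb⟩
    ⟨hf.mem c hc, hf.between c hc⟩
  exact ⟨m, hm.1, hf.between_of_between ha hb hab h1, hf.between_of_between hb hc hbc h2,
    hf.between_of_between ha hc hac h3⟩

theorem HasFeet.isCaterpillarGraph (hX : IsRealTree X) {f : X → X} (hf : HasFeet V u v f)
    (hV : V.Finite) (hu : u ∈ V) (hv : v ∈ V) : IsCaterpillarGraph (neighborGraph V) := by
  have hm := hf.medianClosed hX
  have htree := neighborGraph_isTree hX hV ⟨u, hu⟩ hm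
  obtain ⟨p, hp⟩ := htree.connected.exists_isPath ⟨u, hu⟩ ⟨v, hv⟩
  refine ⟨htree, _, _, p, hp, fun w hw => ?_⟩
  have hfw : ⟨f w, hf.mem w w.2⟩ ∈ p.support :=
    mem_support_of_between hX hm p hp (hf.between w w.2)
  have hne : w ≠ ⟨f w, hf.mem w w.2⟩ := fun e => hw (e ▸ hfw)
  refine ⟨_, hfw, fun x => ⟨fun hx => ?_, ?_⟩⟩
  · have := hx.2 ⟨f w, hf.mem w w.2⟩
      (hf.leg w w.2 x x.2 fun e => hx.1 (Subtype.ext e.symm))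
    exact (this.resolve_left hne.symm).symm
  · rintro rfl
    refine ⟨hne, fun x hx => or_iff_not_imp_left.2 fun hxw => Subtype.ext ?_⟩
    exact hx.antisymm (hf.leg w w.2 x x.2 fun e => hxw (Subtype.ext e))

end Legs

/-! ### Drawings of strict Robinson spaces -/

section Drawing

variable {S X : Type*} [MetricSpace X]

/-- The distances between drawn points strictly increase away from the diagonal of the compatible
order; strictness of `ρ` is what excludes ties. -/
theorem dist_lt_of_isValidDrawing [LinearOrder S] {ρ : S → S → ℝ} (hρ : IsDissimilarity ρ)
    (hs : IsStrict ρ) (hr : ∀ x y z : S, x < y → y < z → max (ρ x y) (ρ y z) ≤ ρ x z)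
    {I : S → X} (hI : IsValidDrawing ρ I) {x y z : S} (hxy : x < y) (hyz : y < z) :
    dist (I x) (I y) < dist (I x) (I z) ∧ dist (I y) (I z) < dist (I x) (I z) := by
  have h := max_le_iff.1 (hr x y z hxy hyz)
  constructor
  · refine hI.dist_lt x y z (lt_of_le_of_ne h.1 (hs _ _ _ _ ?_ (.inl hxy.ne)))
    simp [hyz.ne, (hxy.trans hyz).ne]
  · rw [dist_comm (I y), dist_comm (I x)]
    refine hI.dist_lt z y x ?_
    rw [hρ.symm z y, hρ.symm z x]
    refine lt_of_le_of_ne h.2 (hs _ _ _ _ ?_ (.inl hyz.ne))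
    simp [hxy.ne', (hxy.trans hyz).ne']

/-- Distances between drawn points strictly increase away from the diagonal. -/
def StrictlyRobinson [LinearOrder S] (I : S → X) : Prop :=
  ∀ x y z : S, x < y → y < z →
    dist (I x) (I y) < dist (I x) (I z) ∧ dist (I y) (I z) < dist (I x) (I z)

theorem StrictlyRobinson.strong [LinearOrder S] {I : S → X} (h : StrictlyRobinson I)
    (h4 : FourPointCondition X) {i j k l : S} (hij : i < j) (hjk : j < k) (hkl : k < l) :
    dist (I i) (I j) + dist (I k) (I l) < dist (I i) (I k) + dist (I j) (I l) ∧
      dist (I i) (I k) + dist (I j) (I l) = dist (I i) (I l) + dist (I j) (I k) := by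
  have h1 := (h i j k hij hjk).1
  have h2 := (h j k l hjk hkl).2
  refine ⟨by linarith, le_antisymm ?_ ?_⟩
  · rcases le_max_iff.1 (h4 (I i) (I k) (I j) (I l)) with h | h
    · linarith
    · rwa [dist_comm (I k) (I j)] at h
  · rcases le_max_iff.1 (h4 (I i) (I l) (I j) (I k)) with h | h
    · rw [dist_comm (I l) (I k)] at h
      linarith
    · rwa [dist_comm (I l) (I j)] at h

theorem StrictlyRobinson.strongFourPointCondition [LinearOrder S] {I : S → X}
    (h : StrictlyRobinson I) (hinj : Function.Injective I) (h4 : FourPointCondition X) :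
    StrongFourPointCondition (range I) := by
  refine ⟨fun x y u v => h4 x y u v,
    LinearOrder.lift' (Equiv.ofInjective I hinj).symm (Equiv.injective _), ?_⟩
  intro i j k l hij hjk hkl
  have := h.strong h4 hij hjk hkl
  simp only [Equiv.apply_ofInjective_symm] at this
  exact ⟨this.1.le, this.2⟩

/-- Projections to the geodesic between the extreme drawn points are met in the order of `S`, and
the geodesic between two drawn points goes through both projections. -/
theorem StrictlyRobinson.dist_eq_of_lt [LinearOrder S] [BoundedOrder S] {I p : S → X}
    (h : StrictlyRobinson I) (hX : IsRealTree X)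
    (hp : ∀ j, Between (I ⊥) (p j) (I ⊤) ∧ Between (I ⊤) (p j) (I j) ∧ Between (I ⊥) (p j) (I j))
    {j k : S} (hjk : j < k) :
    dist (I j) (I k) = dist (I j) (p j) + dist (p j) (p k) + dist (p k) (I k) := by
  -- The strong condition for `⊥ ≤ j < k ≤ ⊤`, of which the degenerate cases are trivial.
  have key : dist (I ⊥) (I j) + dist (I k) (I ⊤) ≤ dist (I ⊥) (I k) + dist (I j) (I ⊤) ∧
      dist (I ⊥) (I k) + dist (I j) (I ⊤) = dist (I ⊥) (I ⊤) + dist (I j) (I k) := by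
    rcases eq_bot_or_bot_lt j with rfl | hj
    · rw [dist_self]
      exact ⟨by linarith [dist_triangle (I k) (I ⊥) (I ⊤), dist_comm (I k) (I ⊥)], by ring⟩
    · rcases eq_top_or_lt_top k with rfl | hk
      · rw [dist_self]
        exact ⟨by linarith [dist_triangle (I ⊥) (I ⊤) (I j), dist_comm (I ⊤) (I j)], rfl⟩
      · exact (h.strong hX.fourPointCondition hj hjk hk).imp_left le_of_lt
  obtain ⟨j1, j2, j3⟩ := hp j
  obtain ⟨k1, k2, k3⟩ := hp k
  have hd := hX.dist_eq_abs_sub j1 k1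
  unfold Between at *
  rw [dist_comm (I ⊤) (p j), dist_comm (I ⊤) (I j)] at j2
  rw [dist_comm (I ⊤) (p k), dist_comm (I ⊤) (I k)] at k2
  rw [abs_of_nonpos (by linarith)] at hd
  rw [hd, dist_comm (I j) (p j)]
  linarith

theorem StrictlyRobinson.dist_eq_of_ne [LinearOrder S] [BoundedOrder S] {I p : S → X}
    (h : StrictlyRobinson I) (hX : IsRealTree X)
    (hp : ∀ j, Between (I ⊥) (p j) (I ⊤) ∧ Between (I ⊤) (p j) (I j) ∧ Between (I ⊥) (p j) (I j))
    {j k : S} (hjk : j ≠ k) :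
    dist (I j) (I k) = dist (I j) (p j) + dist (p j) (p k) + dist (p k) (I k) := by
  rcases hjk.lt_or_gt with hjk | hjk
  · exact h.dist_eq_of_lt hX hp hjk
  · have := h.dist_eq_of_lt hX hp hjk
    rw [dist_comm (I j) (I k), this, dist_comm (I k) (p k), dist_comm (p k) (p j),
      dist_comm (p j) (I j)]
    ring

open Classical in
/-- In a real tree, the drawn points and their projections `p j` to the geodesic between the extreme
drawn points form a set with feet. -/
theorem StrictlyRobinson.hasFeet [LinearOrder S] [BoundedOrder S] {I p : S → X}
    (h : StrictlyRobinson I) (hX : IsRealTree X)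
    (hp : ∀ j, Between (I ⊥) (p j) (I ⊤) ∧ Between (I ⊤) (p j) (I j) ∧
      Between (I ⊥) (p j) (I j)) :
    HasFeet (range I ∪ range p) (I ⊥) (I ⊤)
      (fun a => if a ∈ range p then a else p (Function.invFun I a)) := by
  have hinv : ∀ a ∈ range I ∪ range p, a ∉ range p → I (Function.invFun I a) = a :=
    fun a ha hap => Function.invFun_eq (ha.resolve_right hap)
  have hrange : ∀ a, (if a ∈ range p then a else p (Function.invFun I a)) ∈ range p := by
    intro a
    split_ifs with hap
    exacts [hap, mem_range_self _]
  refine ⟨fun a _ => .inr (hrange a), fun a _ => ?_, fun a _ => if_pos (hrange a), ?_⟩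
  · obtain ⟨j, hj⟩ := hrange a
    rw [← hj]
    exact (hp j).1
  · intro a ha w hw hwa
    split_ifs with hap
    · exact between_left _ _
    have hj := hinv a ha hap
    set j := Function.invFun I a
    rw [← hj] at hwa ⊢
    apply between_of_le
    rcases hw with ⟨k, rfl⟩ | ⟨k, rfl⟩
    · have hjk : j ≠ k := fun e => hwa (e ▸ rfl)
      linarith [h.dist_eq_of_ne hX hp hjk, dist_triangle (p j) (p k) (I k)]
    · by_cases hjk : j = k
      · rw [hjk, dist_self, add_zero]
      · linarith [h.dist_eq_of_ne hX hp hjk, dist_triangle (I j) (p k) (I k)]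

theorem StrictlyRobinson.isCaterpillarWith [Finite S] [LinearOrder S] [BoundedOrder S] {I : S → X}
    (h : StrictlyRobinson I) (hX : IsRealTree X) (hI : ∀ q, ∃ x y, Between (I x) q (I y)) :
    IsCaterpillarWith X (range I) := by
  choose p hp using fun j => hX.exists_median (I ⊥) (I ⊤) (I j)
  have hf := h.hasFeet hX hp
  have hV : (range I ∪ range p).Finite := (finite_range I).union (finite_range p)
  refine ⟨hX, range I ∪ range p, neighborGraph _, hV, subset_union_left,
    hf.isCaterpillarGraph hX hV (.inl ⟨_, rfl⟩) (.inl ⟨_, rfl⟩),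
    fun u v => walkLength_eq_dist hX (hf.medianClosed hX), fun q => ?_⟩
  obtain ⟨x, y, hq⟩ := hI q
  exact exists_adj_mem_seg hX hV ⟨I x, .inl ⟨x, rfl⟩⟩ ⟨I y, .inl ⟨y, rfl⟩⟩ hq

end Drawing

end RobinsonTree

theorem mainTheorem4 {S T : Type*} [Finite S] [Nonempty S] [MetricSpace T]
    (ρ : S → S → ℝ) (hρ : RobinsonTree.IsStrictRobinson ρ)
    (hT : RobinsonTree.IsRealTree T)
    (I : S → T) (hI : RobinsonTree.IsValidDrawing ρ I) :
    RobinsonTree.StrongFourPointCondition (Set.range I) ∧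
      RobinsonTree.IsCaterpillarWith (RobinsonTree.spannedTree I)
        {q | (q : T) ∈ Set.range I} := by
  obtain ⟨_, hr⟩ := hρ.robinson
  have := Fintype.ofFinite S
  let _ : BoundedOrder S := Fintype.toBoundedOrder S
  have hR : RobinsonTree.StrictlyRobinson I := fun x y z hxy hyz =>
    RobinsonTree.dist_lt_of_isValidDrawing hρ.dissimilarity hρ.strict hr hI hxy hyz
  refine ⟨hR.strongFourPointCondition hI.injective hT.fourPointCondition, ?_⟩
  let J : S → RobinsonTree.spannedTree I := fun x =>
    ⟨I x, RobinsonTree.range_subset_spannedTree I ⟨x, rfl⟩⟩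
  have hJ : RobinsonTree.StrictlyRobinson J := hR
  have hrange : {q : RobinsonTree.spannedTree I | (q : T) ∈ Set.range I} = Set.range J := by
    ext q
    exact exists_congr fun x => (Subtype.ext_iff (a1 := J x) (a2 := q)).symm
  rw [hrange]
  exact hJ.isCaterpillarWith (RobinsonTree.isRealTree_spannedTree hT I) fun q =>
    (RobinsonTree.mem_spannedTree_iff hT).1 q.2
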